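/- Let $\Omega\subset\mathbb{C}$ be a closed set, let $m\ge 2$, and let $\mathscr{F}=\{\psi_1,\dots,\psi_m\}$ be an iterated function system on $\Omega$, i.e. each $\psi_i:\Omega\to\Omega$ satisfies $|\psi_i(x)-\psi_i(y)|\le c_i|x-y|$ for all $x,y\in\Omega$ with some $0<c_i<1$. Assume that (a) $\mathscr{F}$ is conformal: there are an open set $W\supset\Omega$ and univalent (holomorphic and injective) functions $\widetilde\psi_i:W\to\mathbb{C}$ with $\widetilde\psi_i(W)\subset W$ and $\widetilde\psi_i|_\Omega=\psi_i$ for $1\le i\le m$; (b) $\mathscr{F}$ satisfies the open set condition: there is a non-empty bounded open set $V$ with $\overline{V}\subset\Omega$ such that $\psi_1(V),\dots,\psi_m(V)$ are pairwise disjoint subsets of $V$; (c) there are numbers $0<b_i<1$ with $|\psi_i(x)-\psi_i(y)|\ge b_i|x-y|$ for all $x,y\in\Omega$ and $1\le i\le m$. Then $\mathscr{F}$ has a unique attractor, i.e. there is a unique non-empty compact set $J\subset\Omega$ with $J=\bigcup_{i=1}^m\psi_i(J)$; there is a unique number $s>0$ with $\sum_{i=1}^m b_i^{s}=1$; and the Hausdorff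 dimension of $J$ satisfies $\dim_H(J)\ge s$. -/

import Mathlib

/-- `ψ` is a contracting map on `Ω`: it maps `Ω` to itself and shrinks distances there by a
factor `c ∈ (0, 1)`. The values of `ψ` outside `Ω` are irrelevant. -/
def IsContractingMapOn {X : Type*} [MetricSpace X] (Ω : Set X) (ψ : X → X) : Prop :=
  Set.MapsTo ψ Ω Ω ∧
    ∃ c : ℝ, 0 < c ∧ c < 1 ∧ ∀ x ∈ Ω, ∀ y ∈ Ω, dist (ψ x) (ψ y) ≤ c * dist x y

/-- A finite family of at least two contracting maps on the closed set `Ω`. -/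
structure IsIteratedFunctionSystem {X : Type*} [MetricSpace X] {m : ℕ}
    (Ω : Set X) (ψ : Fin m → X → X) : Prop where
  isClosed : IsClosed Ω
  two_le : 2 ≤ m
  contracting : ∀ i, IsContractingMapOn Ω (ψ i)

/-- `J` is an attractor of the system: a non-empty compact subset of `Ω` with
`J = ⋃ i, ψ i (J)`. -/
structure IsAttractor {X : Type*} [MetricSpace X] {m : ℕ}
    (Ω : Set X) (ψ : Fin m → X → X) (J : Set X) : Prop where
  nonempty : J.Nonempty
  isCompact : IsCompact J
  subset : J ⊆ Ω
  eq_iUnion : J = ⋃ i, ψ i '' J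

/-- The open set condition: there is a non-empty bounded open set `V`, whose closure lies in the
common domain `Ω` of the maps, such that the images `ψ i (V)` are pairwise disjoint subsets
of `V`. -/
def OpenSetCondition {X : Type*} [MetricSpace X] {m : ℕ}
    (Ω : Set X) (ψ : Fin m → X → X) : Prop :=
  ∃ V : Set X, V.Nonempty ∧ Bornology.IsBounded V ∧ IsOpen V ∧ closure V ⊆ Ω ∧
    (∀ i, ψ i '' V ⊆ V) ∧ Pairwise fun i j => Disjoint (ψ i '' V) (ψ j '' V)

/-- `f` is univalent (holomorphic and injective) on the open set `W ⊆ ℂ`. -/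
def IsUnivalentOn (f : ℂ → ℂ) (W : Set ℂ) : Prop :=
  DifferentiableOn ℂ f W ∧ Set.InjOn f W

/-- A conformal iterated function system on `Ω ⊆ ℂ`: the maps extend to univalent self-maps of
one common open neighbourhood `W` of `Ω`. -/
structure IsConformalIFS {m : ℕ} (Ω : Set ℂ) (ψ : Fin m → ℂ → ℂ) : Prop where
  isIFS : IsIteratedFunctionSystem Ω ψ
  exists_extension : ∃ (W : Set ℂ) (ψ' : Fin m → ℂ → ℂ), IsOpen W ∧ Ω ⊆ W ∧
    ∀ i, IsUnivalentOn (ψ' i) W ∧ Set.MapsTo (ψ' i) W W ∧ Set.EqOn (ψ' i) (ψ i) Ω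

/-! The attractor is the range of the coding map `φ`, which sends an infinite sequence of letters to
the limit of the compositions along its initial words. It is unique because a point of one attractor
farthest from another one is the image of a point that was farther still, unless the distance is
zero.

For the dimension, give the letter `i` the weight `b i ^ s`, push the Bernoulli measure forward
under `φ` and apply the mass distribution principle: a disc of radius `r` must have mass at most a
constant times `r ^ s`. Measure the size of a word by the distance between the images of two fixed
points `a`, `a'` of the open set `V`, and cut each sequence at its first initial word of size at
most `r`. The lower ratios bound the mass of such a cylinder by `(r / dist a a') ^ s`. It remains to
bound the number of stopped words whose image of `closure V` meets the disc.

Here conformality enters: the difference quotients of a word map agree up to a factor independent of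
the word (`exists_bounded_distortion`). So the image of `V` under a stopped word contains a disc of
radius comparable to `r`. Stopped words are not prefixes of one another, hence these discs are
disjoint, and comparing areas bounds their number (`exists_card_stoppedWords_le`). -/

open Set Metric Filter Topology MeasureTheory

/-! ### Words and their compositions -/

/-- The composition `ψ i₁ ∘ ⋯ ∘ ψ iₙ` along the word `[i₁, …, iₙ]`. -/
def wordMap {ι X : Type*} (ψ : ι → X → X) : List ι → X → X
  | [] => id
  | i :: w => ψ i ∘ wordMap ψ w

lemma wordMap_append {ι X : Type*} (ψ : ι → X → X) (u v : List ι) (x : X) :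
    wordMap ψ (u ++ v) x = wordMap ψ u (wordMap ψ v x) := by
  induction u with
  | nil => rfl
  | cons i u ih => simp [wordMap, ih]

lemma mapsTo_wordMap {ι X : Type*} {ψ : ι → X → X} {S : Set X}
    (h : ∀ i, MapsTo (ψ i) S S) (w : List ι) : MapsTo (wordMap ψ w) S S := by
  induction w with
  | nil => exact mapsTo_id S
  | cons i w ih => exact (h i).comp ih

lemma dist_wordMap_le {ι X : Type*} [MetricSpace X] {ψ : ι → X → X} {S : Set X} {c : ℝ}
    (hc : 0 ≤ c) (h : ∀ i, MapsTo (ψ i) S S)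
    (hψ : ∀ i, ∀ x ∈ S, ∀ y ∈ S, dist (ψ i x) (ψ i y) ≤ c * dist x y)
    (w : List ι) {x y : X} (hx : x ∈ S) (hy : y ∈ S) :
    dist (wordMap ψ w x) (wordMap ψ w y) ≤ c ^ w.length * dist x y := by
  induction w with
  | nil => simp [wordMap]
  | cons i w ih =>
    calc dist (wordMap ψ (i :: w) x) (wordMap ψ (i :: w) y)
        ≤ c * dist (wordMap ψ w x) (wordMap ψ w y) :=
          hψ i _ (mapsTo_wordMap h w hx) _ (mapsTo_wordMap h w hy)
      _ ≤ c * (c ^ w.length * dist x y) := by gcongr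
      _ = c ^ (i :: w).length * dist x y := by simp [pow_succ]; ring

lemma le_dist_wordMap {ι X : Type*} [MetricSpace X] {ψ : ι → X → X} {S : Set X} {b : ι → ℝ}
    (hb : ∀ i, 0 < b i) (h : ∀ i, MapsTo (ψ i) S S)
    (hψ : ∀ i, ∀ x ∈ S, ∀ y ∈ S, b i * dist x y ≤ dist (ψ i x) (ψ i y))
    (w : List ι) {x y : X} (hx : x ∈ S) (hy : y ∈ S) :
    (w.map b).prod * dist x y ≤ dist (wordMap ψ w x) (wordMap ψ w y) := by
  induction w with
  | nil => simp [wordMap]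
  | cons i w ih =>
    calc ((i :: w).map b).prod * dist x y = b i * ((w.map b).prod * dist x y) := by simp; ring
      _ ≤ b i * dist (wordMap ψ w x) (wordMap ψ w y) := by gcongr; exact (hb i).le
      _ ≤ _ := hψ i _ (mapsTo_wordMap h w hx) _ (mapsTo_wordMap h w hy)

/-- Injectivity allows common first letters to be stripped; words that are not prefixes of each
other then differ in their first letter, where `hdisj` applies. -/
lemma disjoint_wordMap_image {ι X : Type*} {ψ : ι → X → X} {V : Set X}
    (h : ∀ i, MapsTo (ψ i) V V) (hinj : ∀ i, InjOn (ψ i) V)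
    (hdisj : Pairwise fun i j => Disjoint (ψ i '' V) (ψ j '' V)) :
    ∀ {u v : List ι}, ¬ u <+: v → ¬ v <+: u →
      Disjoint (wordMap ψ u '' V) (wordMap ψ v '' V)
  | [], _, hu, _ => absurd List.nil_prefix hu
  | _ :: _, [], _, hv => absurd List.nil_prefix hv
  | i :: u, j :: v, hu, hv => by
    have key := fun (huv : ¬ u <+: v) hvu => disjoint_wordMap_image h hinj hdisj huv hvu
    rw [Set.disjoint_left] at key ⊢
    rintro _ ⟨x, hx, rfl⟩ ⟨y, hy, hxy⟩
    have hxu := mapsTo_wordMap h u hx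
    have hyv := mapsTo_wordMap h v hy
    by_cases hij : i = j
    · subst hij
      refine key (fun hp => hu ((List.prefix_cons_inj i).2 hp))
        (fun hp => hv ((List.prefix_cons_inj i).2 hp)) ⟨x, hx, rfl⟩ ⟨y, hy, hinj i hyv hxu hxy⟩
    · exact Set.disjoint_left.1 (hdisj hij) ⟨_, hxu, rfl⟩ ⟨_, hyv, hxy⟩

lemma differentiableOn_wordMap {ι : Type*} {ψ : ι → ℂ → ℂ} {V : Set ℂ}
    (h : ∀ i, MapsTo (ψ i) V V) (hd : ∀ i, DifferentiableOn ℂ (ψ i) V) (w : List ι) :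
    DifferentiableOn ℂ (wordMap ψ w) V := by
  induction w with
  | nil => exact differentiableOn_id
  | cons i w ih => exact (hd i).comp ih (mapsTo_wordMap h w)

/-! ### Bounded distortion -/

/-- The moduli of the difference quotients of a holomorphic function vary in a Lipschitz way on a
compact set. -/
lemma exists_difference_quotient_variation {f : ℂ → ℂ} {W K : Set ℂ} (hW : IsOpen W)
    (hf : DifferentiableOn ℂ f W) (hK : IsCompact K) (hKW : K ⊆ W)
    (hlip : ∀ x ∈ K, ∀ y ∈ K, dist (f x) (f y) ≤ dist x y) :
    ∃ L : ℝ, 0 ≤ L ∧ ∀ ε : ℝ, ∀ x ∈ K, ∀ y ∈ K, ∀ x' ∈ K, ∀ y' ∈ K,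
      dist y x ≤ ε → dist x' x ≤ ε → dist y' x ≤ ε →
        dist (f x) (f y) * dist x' y' ≤
          (dist (f x') (f y') + L * ε * dist x' y') * dist x y := by
  obtain ⟨δ, hδ, hδW⟩ := hK.exists_cthickening_subset_open hW hKW
  have hf2 : ContinuousOn (deriv (deriv f)) W := ((hf.deriv hW).deriv hW).continuousOn
  obtain ⟨M, hM⟩ := (hK.cthickening (r := δ)).exists_bound_of_continuousOn (hf2.mono hδW)
  -- For `ε ≤ δ`, each of the two difference quotients is within `max M 0 * ε` of `‖deriv f x‖`. For
  -- `ε > δ`, the term `1 / δ` makes the error exceed 1, and `hlip` suffices.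
  refine ⟨2 * max M 0 + 1 / δ, by positivity, fun ε x hx y hy x' hx' y' hy' hyx hx'x hy'x => ?_⟩
  have hε : 0 ≤ ε := dist_nonneg.trans hyx
  have hd := dist_nonneg (x := x) (y := y)
  have hd' := dist_nonneg (x := x') (y := y')
  rcases le_or_gt ε δ with hεδ | hεδ
  · have hball : closedBall x ε ⊆ cthickening δ K :=
      (closedBall_subset_closedBall hεδ).trans (closedBall_subset_cthickening hx δ)
    have hxε : x ∈ closedBall x ε := mem_closedBall_self hε
    have hW' : ∀ p ∈ closedBall x ε, p ∈ W := fun p hp => hδW (hball hp)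
    have hder : ∀ p ∈ closedBall x ε, ‖deriv f p - deriv f x‖ ≤ max M 0 * ε := by
      intro p hp
      have h1 := (convex_closedBall x ε).norm_image_sub_le_of_norm_deriv_le (f := deriv f)
        (C := max M 0) (fun q hq => (hf.deriv hW).differentiableAt (hW.mem_nhds (hW' q hq)))
        (fun q hq => (hM q (hball hq)).trans (le_max_left _ _)) hxε hp
      refine h1.trans ?_
      gcongr
      exact mem_closedBall_iff_norm.1 hp
    have hlin : ∀ p ∈ closedBall x ε, ∀ q ∈ closedBall x ε,
        ‖f p - f q - deriv f x * (p - q)‖ ≤ max M 0 * ε * ‖p - q‖ := by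
      intro p hp q hq
      have h1 := (convex_closedBall x ε).norm_image_sub_le_of_norm_hasDerivWithin_le
        (f := fun z => f z - deriv f x * z) (f' := fun z => deriv f z - deriv f x)
        (C := max M 0 * ε) (fun z hz => by
          have h2 := (hf.differentiableAt (hW.mem_nhds (hW' z hz))).hasDerivAt
          simpa using (h2.fun_sub ((hasDerivAt_id' z).const_mul (deriv f x))).hasDerivWithinAt)
        hder hq hp
      rwa [show f p - f q - deriv f x * (p - q) =
        f p - deriv f x * p - (f q - deriv f x * q) by ring]
    have h1 : dist (f x) (f y) ≤ (‖deriv f x‖ + max M 0 * ε) * dist x y := by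
      have := norm_sub_norm_le (f x - f y) (deriv f x * (x - y))
      have h2 := hlin x hxε y hyx
      rw [norm_mul] at this
      rw [dist_eq_norm, dist_eq_norm]
      linarith
    have h2 : (‖deriv f x‖ - max M 0 * ε) * dist x' y' ≤ dist (f x') (f y') := by
      have := norm_sub_norm_le (deriv f x * (x' - y')) (f x' - f y')
      have h2 := hlin x' hx'x y' hy'x
      rw [norm_mul] at this
      rw [norm_sub_rev] at h2
      rw [dist_eq_norm, dist_eq_norm]
      linarith
    have h3 : 0 ≤ 1 / δ * ε * dist x' y' := by positivity
    calc dist (f x) (f y) * dist x' y'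
        ≤ (‖deriv f x‖ + max M 0 * ε) * dist x y * dist x' y' := by gcongr
      _ = ((‖deriv f x‖ - max M 0 * ε) * dist x' y' + 2 * max M 0 * ε * dist x' y')
            * dist x y := by ring
      _ ≤ _ := by
        refine mul_le_mul_of_nonneg_right ?_ hd
        linarith
  · have h1 : 1 ≤ (2 * max M 0 + 1 / δ) * ε := by
      have h2 : 0 ≤ 2 * max M 0 * ε := by positivity
      have h3 : 1 ≤ 1 / δ * ε := by
        rw [one_div, inv_mul_eq_div, le_div_iff₀ hδ]
        linarith
      linarith
    calc dist (f x) (f y) * dist x' y' ≤ dist x y * dist x' y' := by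
          gcongr
          exact hlip x hx y hy
      _ = (0 + 1 * dist x' y') * dist x y := by ring
      _ ≤ _ := by gcongr; exact dist_nonneg

/-- Bounded distortion of the compositions of a conformal iterated function system. -/
lemma exists_bounded_distortion {ι : Type*} [Finite ι] {ψ : ι → ℂ → ℂ} {K : Set ℂ} {c β : ℝ}
    (hK : IsCompact K) (hc : 0 ≤ c) (hc1 : c < 1) (hβ : 0 < β)
    (hmaps : ∀ i, MapsTo (ψ i) K K)
    (hup : ∀ i, ∀ x ∈ K, ∀ y ∈ K, dist (ψ i x) (ψ i y) ≤ c * dist x y)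
    (hlow : ∀ i, ∀ x ∈ K, ∀ y ∈ K, β * dist x y ≤ dist (ψ i x) (ψ i y))
    (hext : ∀ i, ∃ W : Set ℂ, ∃ f : ℂ → ℂ, IsOpen W ∧ K ⊆ W ∧ DifferentiableOn ℂ f W ∧
      EqOn f (ψ i) K) :
    ∃ C : ℝ, 0 < C ∧ ∀ w : List ι, ∀ x ∈ K, ∀ y ∈ K, ∀ x' ∈ K, ∀ y' ∈ K,
      dist (wordMap ψ w x) (wordMap ψ w y) * dist x' y' ≤
        C * dist (wordMap ψ w x') (wordMap ψ w y') * dist x y := by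
  have hL : ∀ i, ∃ L : ℝ, 0 ≤ L ∧ ∀ ε : ℝ, ∀ x ∈ K, ∀ y ∈ K, ∀ x' ∈ K, ∀ y' ∈ K,
      dist y x ≤ ε → dist x' x ≤ ε → dist y' x ≤ ε →
        dist (ψ i x) (ψ i y) * dist x' y' ≤
          (dist (ψ i x') (ψ i y') + L * ε * dist x' y') * dist x y := by
    intro i
    obtain ⟨W, f, hW, hKW, hf, hfe⟩ := hext i
    obtain ⟨L, hL0, hL⟩ := exists_difference_quotient_variation hW hf hK hKW fun x hx y hy => by
      rw [hfe hx, hfe hy]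
      exact (hup i x hx y hy).trans (mul_le_of_le_one_left dist_nonneg hc1.le)
    refine ⟨L, hL0, fun ε x hx y hy x' hx' y' hy' h1 h2 h3 => ?_⟩
    simpa only [hfe hx, hfe hy, hfe hx', hfe hy'] using hL ε x hx y hy x' hx' y' hy' h1 h2 h3
  choose L hL using hL
  obtain ⟨Λ, hΛ⟩ := (Set.finite_range L).bddAbove
  have hΛ : ∀ i, L i ≤ Λ := fun i => hΛ ⟨i, rfl⟩
  set A : ℝ := max Λ 0 * diam K / β with hA
  have hA0 : 0 ≤ A := by positivity
  -- The outermost letter acts on points of the image of `K` under the remaining word, of length `k`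
  -- say. These lie within `c ^ k * diam K` of each other, so this letter costs a factor `1 + A * c
  -- ^ k`.
  have hfin : ∀ w : List ι, ∀ x ∈ K, ∀ y ∈ K, ∀ x' ∈ K, ∀ y' ∈ K,
      dist (wordMap ψ w x) (wordMap ψ w y) * dist x' y' ≤
        (∏ k ∈ Finset.range w.length, (1 + A * c ^ k)) *
          dist (wordMap ψ w x') (wordMap ψ w y') * dist x y := by
    intro w
    induction w with
    | nil => intro x _ y _ x' _ y' _; simp [wordMap, mul_comm]
    | cons i w ih =>
      intro x hx y hy x' hx' y' hy'
      have hP : 0 ≤ ∏ k ∈ Finset.range w.length, (1 + A * c ^ k) :=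
        Finset.prod_nonneg fun k _ => by positivity
      have mK : ∀ {z}, z ∈ K → wordMap ψ w z ∈ K := fun hz => mapsTo_wordMap hmaps w hz
      have hdia : ∀ z ∈ K, dist (wordMap ψ w z) (wordMap ψ w x) ≤ c ^ w.length * diam K :=
        fun z hz => (dist_wordMap_le hc hmaps hup w hz hx).trans <| by
          gcongr
          exact dist_le_diam_of_mem hK.isBounded hz hx
      have h1 := ih x hx y hy x' hx' y' hy'
      have h2 := (hL i).2 _ _ (mK hx) _ (mK hy) _ (mK hx') _ (mK hy') (hdia y hy) (hdia x' hx')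
        (hdia y' hy')
      have h3 := hlow i _ (mK hx') _ (mK hy')
      simp only [wordMap, Function.comp, List.length_cons, Finset.prod_range_succ]
      set Y := wordMap ψ w x
      set Z := wordMap ψ w y
      set Y' := wordMap ψ w x'
      set Z' := wordMap ψ w y'
      set P := ∏ k ∈ Finset.range w.length, (1 + A * c ^ k)
      have h4 : dist (ψ i Y) (ψ i Z) * dist Y' Z' ≤
          (1 + A * c ^ w.length) * dist (ψ i Y') (ψ i Z') * dist Y Z := by
        refine h2.trans ?_
        gcongr
        calc dist (ψ i Y') (ψ i Z') + L i * (c ^ w.length * diam K) * dist Y' Z'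
            ≤ dist (ψ i Y') (ψ i Z') + max Λ 0 * (c ^ w.length * diam K) *
                (dist (ψ i Y') (ψ i Z') / β) := by
              gcongr
              · exact (hΛ i).trans (le_max_left _ _)
              · rw [le_div_iff₀ hβ]; linarith
          _ = (1 + A * c ^ w.length) * dist (ψ i Y') (ψ i Z') := by rw [hA]; ring
      -- The two estimates are combined by cancelling `dist Y' Z'`; if it vanishes, the lower bound
      -- forces `x' = y'`.
      rcases eq_or_lt_of_le (dist_nonneg (x := Y') (y := Z')) with h0 | h0
      · have hx'y' : dist x' y' = 0 := by
          have := le_dist_wordMap (b := fun _ => β) (fun _ => hβ) hmaps hlow w hx' hy'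
          have hpos : 0 < (w.map fun _ => β).prod := by simp; positivity
          change _ ≤ dist Y' Z' at this
          rw [← h0] at this
          nlinarith [dist_nonneg (x := x') (y := y')]
        rw [hx'y', mul_zero]
        positivity
      · refine le_of_mul_le_mul_right ?_ h0
        calc dist (ψ i Y) (ψ i Z) * dist x' y' * dist Y' Z'
            = dist (ψ i Y) (ψ i Z) * dist Y' Z' * dist x' y' := by ring
          _ ≤ (1 + A * c ^ w.length) * dist (ψ i Y') (ψ i Z') * dist Y Z * dist x' y' := by gcongr
          _ = (1 + A * c ^ w.length) * dist (ψ i Y') (ψ i Z') * (dist Y Z * dist x' y') := by ring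
          _ ≤ (1 + A * c ^ w.length) * dist (ψ i Y') (ψ i Z') * (P * dist Y' Z' * dist x y) := by
              gcongr
          _ = _ := by ring
  refine ⟨Real.exp (A * (1 - c)⁻¹), Real.exp_pos _, fun w x hx y hy x' hx' y' hy' => ?_⟩
  refine (hfin w x hx y hy x' hx' y' hy').trans ?_
  gcongr
  calc ∏ k ∈ Finset.range w.length, (1 + A * c ^ k)
      ≤ ∏ k ∈ Finset.range w.length, Real.exp (A * c ^ k) := by
        refine Finset.prod_le_prod (fun k _ => by positivity) fun k _ => ?_
        rw [add_comm]
        exact Real.add_one_le_exp _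
    _ = Real.exp (A * ∑ k ∈ Finset.range w.length, c ^ k) := by
        rw [← Real.exp_sum, Finset.mul_sum]
    _ ≤ _ := by
        gcongr
        rw [← tsum_geometric_of_lt_one hc hc1]
        exact (summable_geometric_of_lt_one hc hc1).sum_le_tsum _ fun k _ => by positivity

/-! ### Coding map and attractor -/

/-- The word formed by the first `n` letters of the sequence `ω`. -/
def initialWord {ι : Type*} (ω : ℕ → ι) (n : ℕ) : List ι := (List.range n).map ω

@[simp]
lemma length_initialWord {ι : Type*} (ω : ℕ → ι) (n : ℕ) : (initialWord ω n).length = n := by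
  simp [initialWord]

lemma initialWord_succ {ι : Type*} (ω : ℕ → ι) (n : ℕ) :
    initialWord ω (n + 1) = initialWord ω n ++ [ω n] := by
  simp [initialWord, List.range_succ]

lemma initialWord_succ_eq_cons {ι : Type*} (ω : ℕ → ι) (n : ℕ) :
    initialWord ω (n + 1) = ω 0 :: initialWord (fun k => ω (k + 1)) n := by
  simp [initialWord, List.range_succ_eq_map, Function.comp_def]

lemma eq_initialWord_of_prefix {ι : Type*} {ω : ℕ → ι} {n : ℕ} {u : List ι}
    (hu : u <+: initialWord ω n) : u = initialWord ω u.length := by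
  have hlen : u.length ≤ n := by simpa using hu.length_le
  rw [List.prefix_iff_eq_take] at hu
  conv_lhs => rw [hu]
  simp [initialWord, ← List.map_take, List.take_range, hlen]

/-- This makes the finite approximations of the coding map continuous, and continuity passes to
their uniform limit. -/
lemma isLocallyConstant_initialWord {ι : Type*} [TopologicalSpace ι] [DiscreteTopology ι]
    (n : ℕ) : IsLocallyConstant fun ω : ℕ → ι => initialWord ω n := by
  induction n with
  | zero => exact IsLocallyConstant.const []
  | succ n ih =>
    simp only [initialWord_succ]
    exact ih.comp₂ ((IsLocallyConstant.of_discrete id).comp_continuous (continuous_apply n))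
      fun w i => w ++ [i]

/-- The coding map from sequences of letters to points of a compact invariant set. -/
lemma exists_codingMap {ι X : Type*} [TopologicalSpace ι] [DiscreteTopology ι] [MetricSpace X]
    {ψ : ι → X → X} {K : Set X} {c : ℝ} (hK : IsCompact K) (hne : K.Nonempty)
    (hc : 0 ≤ c) (hc1 : c < 1) (hmaps : ∀ i, MapsTo (ψ i) K K)
    (hψ : ∀ i, ∀ x ∈ K, ∀ y ∈ K, dist (ψ i x) (ψ i y) ≤ c * dist x y) :
    ∃ φ : (ℕ → ι) → X, Continuous φ ∧ (∀ ω, φ ω ∈ K) ∧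
      ∀ ω, φ ω = ψ (ω 0) (φ fun k => ω (k + 1)) := by
  obtain ⟨x₀, hx₀⟩ := hne
  set P : ℕ → (ℕ → ι) → X := fun n ω => wordMap ψ (initialWord ω n) x₀ with hP
  have hPK : ∀ n ω, P n ω ∈ K := fun n ω => mapsTo_wordMap hmaps _ hx₀
  have hstep : ∀ ω n, dist (P n ω) (P (n + 1) ω) ≤ diam K * c ^ n := by
    intro ω n
    have h1 := dist_wordMap_le hc hmaps hψ (initialWord ω n) hx₀ (hmaps (ω n) hx₀)
    simp only [hP, initialWord_succ, wordMap_append]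
    rw [length_initialWord] at h1
    refine h1.trans ?_
    rw [mul_comm]
    gcongr
    exact dist_le_diam_of_mem hK.isBounded hx₀ (hmaps (ω n) hx₀)
  have hlim : ∀ ω, ∃ p ∈ K, Tendsto (fun n => P n ω) atTop (𝓝 p) := fun ω =>
    cauchySeq_tendsto_of_isComplete hK.isComplete (fun n => hPK n ω)
      (cauchySeq_of_le_geometric c (diam K) hc1 (hstep ω))
  choose φ hφK hφ using hlim
  refine ⟨φ, ?_, hφK, fun ω => ?_⟩
  · have hunif : TendstoUniformly P φ atTop := by
      rw [Metric.tendstoUniformly_iff]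
      intro ε hε
      have h0 : Tendsto (fun n : ℕ => diam K * c ^ n / (1 - c)) atTop (𝓝 0) := by
        simpa using ((tendsto_pow_atTop_nhds_zero_of_lt_one hc hc1).const_mul (diam K)).div_const
          (1 - c)
      filter_upwards [h0.eventually_lt_const hε] with n hn ω
      rw [dist_comm]
      exact (dist_le_of_le_geometric_of_tendsto c (diam K) hc1 (hstep ω) (hφ ω) n).trans_lt hn
    refine hunif.continuous (Eventually.frequently (Eventually.of_forall fun n => ?_))
    exact ((isLocallyConstant_initialWord n).comp fun w => wordMap ψ w x₀).continuous
  · have hcont : ContinuousOn (ψ (ω 0)) K :=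
      (LipschitzOnWith.of_dist_le_mul (K := ⟨c, hc⟩) (hψ (ω 0))).continuousOn
    have h1 : Tendsto (fun n => ψ (ω 0) (P n fun k => ω (k + 1))) atTop
        (𝓝 (ψ (ω 0) (φ fun k => ω (k + 1)))) :=
      (hcont _ (hφK _)).tendsto.comp (tendsto_nhdsWithin_iff.2
        ⟨hφ _, Eventually.of_forall fun n => hPK n _⟩)
    refine tendsto_nhds_unique ((hφ ω).comp (tendsto_add_atTop_nat 1)) (h1.congr fun n => ?_)
    simp [hP, initialWord_succ_eq_cons, wordMap]

lemma codingMap_mem_image {ι X : Type*} {ψ : ι → X → X} {K : Set X} {φ : (ℕ → ι) → X}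
    (hφK : ∀ ω, φ ω ∈ K) (hφ : ∀ ω, φ ω = ψ (ω 0) (φ fun k => ω (k + 1))) (n : ℕ) (ω : ℕ → ι) :
    φ ω ∈ wordMap ψ (initialWord ω n) '' K := by
  induction n generalizing ω with
  | zero => exact ⟨φ ω, hφK ω, rfl⟩
  | succ n ih =>
    obtain ⟨z, hz, hzφ⟩ := ih fun k => ω (k + 1)
    refine ⟨z, hz, ?_⟩
    rw [initialWord_succ_eq_cons, hφ ω, ← hzφ]
    rfl

lemma range_codingMap {ι X : Type*} {ψ : ι → X → X} {φ : (ℕ → ι) → X}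
    (hφ : ∀ ω, φ ω = ψ (ω 0) (φ fun k => ω (k + 1))) : range φ = ⋃ i, ψ i '' range φ := by
  apply Subset.antisymm
  · rintro _ ⟨ω, rfl⟩
    exact mem_iUnion.2 ⟨ω 0, _, ⟨_, rfl⟩, (hφ ω).symm⟩
  · refine iUnion_subset fun i => ?_
    rintro _ ⟨_, ⟨ω, rfl⟩, rfl⟩
    exact ⟨fun n => Nat.casesOn n i ω, hφ _⟩

/-- A compact set covered by its images under uniform contractions lies in every compact
non-empty set that is mapped to itself. -/
lemma subset_of_subset_iUnion_image {ι X : Type*} [MetricSpace X] {ψ : ι → X → X}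
    {Ω A B : Set X} {c : ℝ} (hc1 : c < 1)
    (hψ : ∀ i, ∀ x ∈ Ω, ∀ y ∈ Ω, dist (ψ i x) (ψ i y) ≤ c * dist x y)
    (hA : IsCompact A) (hAΩ : A ⊆ Ω) (hAψ : A ⊆ ⋃ i, ψ i '' A)
    (hB : IsCompact B) (hne : B.Nonempty) (hBΩ : B ⊆ Ω) (hBψ : ∀ i, MapsTo (ψ i) B B) :
    A ⊆ B := by
  intro x hx
  -- A preimage `a'` of the farthest point `a` satisfies `infDist a' B ≤ infDist a B ≤ c * infDist
  -- a' B`, so all distances are zero.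
  obtain ⟨a, ha, hmax⟩ := hA.exists_isMaxOn ⟨x, hx⟩ (continuous_infDist_pt B).continuousOn
  obtain ⟨i, a', ha', rfl⟩ := mem_iUnion.1 (hAψ ha)
  obtain ⟨y, hy, hya⟩ := hB.exists_infDist_eq_dist hne a'
  have h1 : infDist (ψ i a') B ≤ c * infDist a' B := by
    rw [hya]
    exact (infDist_le_dist_of_mem (hBψ i hy)).trans (hψ i _ (hAΩ ha') _ (hBΩ hy))
  have h2 : infDist a' B ≤ infDist (ψ i a') B := hmax ha'
  have h3 : infDist x B ≤ infDist (ψ i a') B := hmax hx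
  have h4 := infDist_nonneg (x := a') (s := B)
  have h5 : infDist a' B = 0 := le_antisymm (by nlinarith) h4
  rw [h5, mul_zero] at h1
  have h6 : infDist x B = 0 := le_antisymm (h3.trans h1) infDist_nonneg
  exact (hB.isClosed.mem_iff_infDist_zero hne).2 h6

/-! ### Mass distribution and Bernoulli measures -/

/-- The mass distribution principle. -/
lemma ofReal_le_dimH_of_measure_closedBall_le {X : Type*} [MetricSpace X] [MeasurableSpace X]
    [BorelSpace X] {ν : Measure X} {A : Set X} {C s r₀ : ℝ} (hs : 0 < s) (hr₀ : 0 < r₀)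
    (hν : ∀ x r, 0 < r → r < r₀ → ν (closedBall x r) ≤ ENNReal.ofReal (C * r ^ s))
    (hA : ν A ≠ 0) : ENNReal.ofReal s ≤ dimH A := by
  set D := max C 1
  have hD : 0 < D := lt_max_of_lt_right one_pos
  have hD0 : ENNReal.ofReal D ≠ 0 := by simpa using hD
  have hle : (ENNReal.ofReal D)⁻¹ • ν ≤ μH[s] := by
    refine Measure.le_hausdorffMeasure s _ (ENNReal.ofReal (r₀ / 2)) (by simpa using hr₀)
      fun S hS => ?_
    rcases S.eq_empty_or_nonempty with rfl | ⟨x, hx⟩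
    · simp
    have hfin : ediam S ≠ ⊤ := ne_top_of_le_ne_top ENNReal.ofReal_ne_top hS
    have ht : ediam S = ENNReal.ofReal (diam S) := (ENNReal.ofReal_toReal hfin).symm
    have hbd : Bornology.IsBounded S := isBounded_iff_ediam_ne_top.2 hfin
    have htr : diam S < r₀ := by
      have : diam S ≤ r₀ / 2 := ENNReal.toReal_le_of_le_ofReal (by positivity) hS
      linarith
    -- The radius is taken above `diam S` and then decreased to it, since `diam S` may be 0 while
    -- `hν` needs a positive radius.
    have hball : ∀ r, diam S < r → r < r₀ → ν S ≤ ENNReal.ofReal (D * r ^ s) := by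
      intro r hr hrr
      have hr0 : 0 < r := diam_nonneg.trans_lt hr
      refine (measure_mono fun y hy => ?_).trans ((hν x r hr0 hrr).trans
        (ENNReal.ofReal_le_ofReal ?_))
      · exact (dist_le_diam_of_mem hbd hy hx).trans hr.le
      · gcongr
        exact le_max_left _ _
    have hlim : Tendsto (fun r : ℝ => ENNReal.ofReal (D * r ^ s)) (𝓝[>] (diam S))
        (𝓝 (ENNReal.ofReal (D * diam S ^ s))) :=
      (ENNReal.continuous_ofReal.comp (continuous_const.mul
        (Real.continuous_rpow_const hs.le))).continuousWithinAt
    have hSle : ν S ≤ ENNReal.ofReal (D * diam S ^ s) := by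
      refine ge_of_tendsto hlim ?_
      filter_upwards [Ioo_mem_nhdsGT htr] with r hr using hball r hr.1 hr.2
    rw [Measure.smul_apply, smul_eq_mul, ht, ENNReal.ofReal_rpow_of_nonneg diam_nonneg hs.le]
    refine ENNReal.inv_mul_le_iff hD0 ENNReal.ofReal_ne_top |>.2 ?_
    rwa [← ENNReal.ofReal_mul hD.le]
  have hne : μH[s] A ≠ 0 := by
    intro h0
    have h1 := hle A
    rw [h0, Measure.smul_apply, smul_eq_mul] at h1
    rcases mul_eq_zero.1 (le_antisymm h1 zero_le) with h | h
    · exact ENNReal.ofReal_ne_top (ENNReal.inv_eq_zero.1 h)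
    · exact hA h
  have := le_dimH_of_hausdorffMeasure_ne_zero (s := A) (d := ⟨s, hs.le⟩) hne
  rwa [ENNReal.ofReal_eq_coe_nnreal hs.le]

/-- A probability vector defines a measure on sequences for which the measure of the cylinder of
a word is the product of the weights of its letters. -/
lemma exists_bernoulli_measure {ι : Type*} [Fintype ι] [MeasurableSpace ι]
    [MeasurableSingletonClass ι] {q : ι → ℝ} (hq : ∀ i, 0 ≤ q i) (hsum : ∑ i, q i = 1) :
    ∃ μ : Measure (ℕ → ι), IsProbabilityMeasure μ ∧
      ∀ w : List ι, μ {ω | initialWord ω w.length = w} ≤ ENNReal.ofReal (w.map q).prod := by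
  classical
  set p : Measure ι := ∑ i, ENNReal.ofReal (q i) • Measure.dirac i with hp
  have hp1 : ∀ i, p {i} = ENNReal.ofReal (q i) := fun i => by
    simp [hp, Measure.finsetSum_apply, Set.indicator_apply, Finset.sum_ite_eq']
  have : IsProbabilityMeasure p := ⟨by
    simp [hp, Measure.finsetSum_apply, ← ENNReal.ofReal_sum_of_nonneg fun i _ => hq i, hsum]⟩
  refine ⟨Measure.infinitePi fun _ => p, inferInstance, fun w => ?_⟩
  rcases eq_empty_or_nonempty {ω | initialWord ω w.length = w} with h | ⟨ω₀, hω₀⟩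
  · simp [h]
  have hcyl : {ω | initialWord ω w.length = w} =
      ((Finset.range w.length : Finset ℕ) : Set ℕ).pi fun k => {ω₀ k} := by
    ext ω
    rw [mem_ofPred_eq] at hω₀ ⊢
    conv_lhs => rhs; rw [← hω₀]
    simp [initialWord, Set.mem_pi]
  have hprod : (w.map q).prod = ∏ k ∈ Finset.range w.length, q (ω₀ k) := by
    rw [mem_ofPred_eq] at hω₀
    conv_lhs => rw [← hω₀]
    simp [initialWord, Finset.prod, Finset.range, Multiset.range, Function.comp_def]
  rw [hcyl, Measure.infinitePi_pi _ fun _ _ => measurableSet_singleton _, hprod,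
    ENNReal.ofReal_prod_of_nonneg fun k _ => hq _]
  simp [hp1]

/-! ### Stopped words and counting -/

lemma card_mul_sq_le_of_disjoint_balls {α : Type*} {F : Finset α} {p : α → ℂ} {x : ℂ} {e R : ℝ}
    (he : 0 ≤ e) (hR : 0 ≤ R)
    (hdisj : (F : Set α).PairwiseDisjoint fun w => ball (p w) e)
    (hsub : ∀ w ∈ F, ball (p w) e ⊆ ball x R) : F.card * e ^ 2 ≤ R ^ 2 := by
  have h1 := measure_biUnion_finset (μ := volume) hdisj fun _ _ => measurableSet_ball
  have h2 : volume (⋃ w ∈ F, ball (p w) e) ≤ volume (ball x R) :=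
    measure_mono (iUnion₂_subset hsub)
  rw [h1] at h2
  simp only [Complex.volume_ball, Finset.sum_const, nsmul_eq_mul, ← mul_assoc] at h2
  have h3 := (ENNReal.mul_le_mul_iff_left (by simp [NNReal.pi_ne_zero]) ENNReal.coe_ne_top).1 h2
  rw [← ENNReal.ofReal_pow he, ← ENNReal.ofReal_pow hR, ← ENNReal.ofReal_natCast,
    ← ENNReal.ofReal_mul (by positivity)] at h3
  exact (ENNReal.ofReal_le_ofReal_iff (by positivity)).1 h3

/-- The words at which the size `l` drops to at most `r` for the first time. -/
def stoppedWords {ι : Type*} (l : List ι → ℝ) (r : ℝ) : Set (List ι) :=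
  {w | l w ≤ r ∧ ∀ u, u <+: w → u ≠ w → r < l u}

lemma not_prefix_of_mem_stoppedWords {ι : Type*} {l : List ι → ℝ} {r : ℝ} {u v : List ι}
    (hu : u ∈ stoppedWords l r) (hv : v ∈ stoppedWords l r) (huv : u ≠ v) : ¬ u <+: v :=
  fun h => (hv.2 u h huv).not_ge hu.1

lemma exists_initialWord_mem_stoppedWords {ι : Type*} {l : List ι → ℝ} {r : ℝ} {ω : ℕ → ι}
    (h : ∃ n, l (initialWord ω n) ≤ r) : ∃ n, initialWord ω n ∈ stoppedWords l r := by
  classical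
  refine ⟨Nat.find h, Nat.find_spec h, fun u hu hne => ?_⟩
  have hu' := eq_initialWord_of_prefix hu
  have hlt : u.length < Nat.find h := by
    refine lt_of_le_of_ne (by simpa using hu.length_le) fun heq => hne ?_
    rw [hu', heq]
  rw [hu']
  exact not_le.1 (Nat.find_min h hlt)

/-- The sum is continuous and strictly decreasing in the exponent, exceeds 1 at 0 and tends to 0 at
infinity. -/
lemma existsUnique_rpow_sum_eq_one {ι : Type*} [Fintype ι] (hcard : 1 < Fintype.card ι)
    {b : ι → ℝ} (hb : ∀ i, 0 < b i ∧ b i < 1) : ∃! s : ℝ, 0 < s ∧ ∑ i, b i ^ s = 1 := by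
  have hne : (Finset.univ : Finset ι).Nonempty :=
    Finset.univ_nonempty_iff.2 (Fintype.card_pos_iff.1 (by lia))
  have hanti : StrictAnti fun s : ℝ => ∑ i, b i ^ s := fun s t hst =>
    Finset.sum_lt_sum_of_nonempty hne fun i _ =>
      Real.rpow_lt_rpow_of_exponent_gt (hb i).1 (hb i).2 hst
  have hcont : Continuous fun s : ℝ => ∑ i, b i ^ s :=
    continuous_finsetSum _ fun i _ => Real.continuous_const_rpow (hb i).1.ne'
  have hlim : Tendsto (fun s : ℝ => ∑ i, b i ^ s) atTop (𝓝 0) := by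
    simpa using tendsto_finsetSum Finset.univ fun i _ =>
      tendsto_rpow_atTop_of_base_lt_one (b i) (by linarith [(hb i).1]) (hb i).2
  have h0 : 1 < ∑ i, b i ^ (0 : ℝ) := by simpa using hcard
  obtain ⟨t, ht⟩ := (hlim.eventually_lt_const one_pos).exists
  obtain ⟨s, hs⟩ := mem_range_of_exists_le_of_exists_ge hcont ⟨t, ht.le⟩ ⟨0, h0.le⟩
  refine ⟨s, ⟨?_, hs⟩, fun s' hs' => hanti.injective (hs'.2.trans hs.symm)⟩
  exact hanti.lt_iff_gt.1 (by simpa only [hs] using h0)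

/-- Under bounded distortion and the open set condition, boundedly many stopped words have images
that meet a given disc of comparable radius. -/
lemma exists_card_stoppedWords_le {ι : Type*} {ψ : ι → ℂ → ℂ} {K V : Set ℂ} {β C : ℝ} {a a' : ℂ}
    (hK : IsCompact K) (hV : IsOpen V) (hVK : V ⊆ K) (hβ : 0 < β)
    (hmaps : ∀ i, MapsTo (ψ i) K K) (hmapsV : ∀ i, MapsTo (ψ i) V V)
    (hdiff : ∀ i, DifferentiableOn ℂ (ψ i) V)
    (hlow : ∀ i, ∀ x ∈ K, ∀ y ∈ K, β * dist x y ≤ dist (ψ i x) (ψ i y))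
    (hdisj : Pairwise fun i j => Disjoint (ψ i '' V) (ψ j '' V))
    (ha : a ∈ V) (ha' : a' ∈ K) (haa' : a ≠ a') (hC : 0 < C)
    (hdist : ∀ w : List ι, ∀ x ∈ K, ∀ y ∈ K, ∀ x' ∈ K, ∀ y' ∈ K,
      dist (wordMap ψ w x) (wordMap ψ w y) * dist x' y' ≤
        C * dist (wordMap ψ w x') (wordMap ψ w y') * dist x y) :
    ∃ N : ℕ, ∀ r, 0 < r → r < dist a a' → ∀ x, ∀ F : Finset (List ι),
      (∀ w ∈ F, w ∈ stoppedWords (fun w => dist (wordMap ψ w a) (wordMap ψ w a')) r ∧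
        (wordMap ψ w '' K ∩ closedBall x r).Nonempty) → F.card ≤ N := by
  obtain ⟨ρ, hρ, hρV⟩ := nhds_basis_closedBall.mem_iff.1 (hV.mem_nhds ha)
  have haK := hVK ha
  set d := dist a a'
  have hd : 0 < d := dist_pos.2 haa'
  -- `κ * r` bounds from below the distance from the image of `a` to the image of the circle of
  -- radius `ρ` about `a`; below, `E * r` bounds the distance from the image of `a` to any point of
  -- the image of `K`.
  set κ := β * ρ / (C ^ 2 * d) with hκ
  have hκ0 : 0 < κ := by positivity
  set E := C * diam K / d with hE
  have hE0 : 0 ≤ E := by positivity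
  have hinj : ∀ i, InjOn (ψ i) V := fun i x hx y hy hxy => by
    have h1 := hlow i x (hVK hx) y (hVK hy)
    rw [hxy, dist_self] at h1
    exact dist_le_zero.1 (by nlinarith [dist_nonneg (x := x) (y := y)])
  have hpos : ∀ w : List ι, ∀ z ∈ K, z ≠ a → 0 < dist (wordMap ψ w z) (wordMap ψ w a) := by
    intro w z hz hza
    have h1 := le_dist_wordMap (b := fun _ => β) (fun _ => hβ) hmaps hlow w hz haK
    have h2 : 0 < (w.map fun _ => β).prod := by simp; positivity
    exact (mul_pos h2 (dist_pos.2 hza)).trans_le h1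
  refine ⟨⌈(1 + E + κ) ^ 2 * 4 / κ ^ 2⌉₊, fun r hr hrd x F hF => ?_⟩
  -- Removing the last letter gives a word of size above `r`, and by distortion that letter shrinks
  -- the size by at most `β / C`. The empty word is not stopped because `r < d`.
  have hsize : ∀ w ∈ F, β * r ≤ C * dist (wordMap ψ w a) (wordMap ψ w a') := by
    intro w hw
    obtain ⟨⟨hwr, hpre⟩, -⟩ := hF w hw
    rcases List.eq_nil_or_concat w with rfl | ⟨u, i, rfl⟩
    · exact absurd hwr (not_le.2 hrd)
    · have h1 : r < dist (wordMap ψ u a) (wordMap ψ u a') :=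
        hpre u (by simp) (by simp)
      have h2 := hdist u a haK a' ha' _ (hmaps i haK) _ (hmaps i ha')
      have h3 := hlow i a haK a' ha'
      rw [List.concat_eq_append, wordMap_append, wordMap_append]
      refine le_of_mul_le_mul_right ?_ hd
      calc β * r * d = r * (β * d) := by ring
        _ ≤ dist (wordMap ψ u a) (wordMap ψ u a') * dist (ψ i a) (ψ i a') := by gcongr
        _ ≤ _ := h2
  -- Quantitative open mapping: a lower bound `κ * r` on the boundary circle yields a disc of half
  -- that radius in the image.
  have hball : ∀ w ∈ F, ball (wordMap ψ w a) (κ * r / 2) ⊆ wordMap ψ w '' V := by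
    intro w hw
    have hdw : DifferentiableOn ℂ (wordMap ψ w) V := differentiableOn_wordMap hmapsV hdiff w
    have hcl : DiffContOnCl ℂ (wordMap ψ w) (ball a ρ) :=
      (hdw.mono (by rwa [closure_ball a hρ.ne'])).diffContOnCl
    refine (hcl.ball_subset_image_closedBall hρ (ε := κ * r) (fun z hz => ?_) ?_).trans
      (image_mono hρV)
    · have hzK : z ∈ K := hVK (hρV (sphere_subset_closedBall hz))
      have h1 := hdist w a haK a' ha' z hzK a haK
      have h2 := hsize w hw
      rw [mem_sphere.1 hz] at h1
      rw [← dist_eq_norm, hκ, div_mul_eq_mul_div, div_le_iff₀ (by positivity)]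
      calc β * ρ * r = β * r * ρ := by ring
        _ ≤ C * dist (wordMap ψ w a) (wordMap ψ w a') * ρ := by gcongr
        _ = C * (dist (wordMap ψ w a) (wordMap ψ w a') * ρ) := by ring
        _ ≤ C * (C * dist (wordMap ψ w z) (wordMap ψ w a) * d) := by gcongr
        _ = _ := by ring
    · have h1 : ∀ᶠ z in 𝓝[≠] a, wordMap ψ w z ≠ wordMap ψ w a := by
        filter_upwards [self_mem_nhdsWithin, mem_nhdsWithin_of_mem_nhds (hV.mem_nhds ha)]
          with z hza hzV
        exact dist_pos.1 (hpos w z (hVK hzV) hza)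
      exact h1.frequently.filter_mono nhdsWithin_le_nhds
  have hnear : ∀ w ∈ F, ball (wordMap ψ w a) (κ * r / 2) ⊆ ball x ((1 + E + κ) * r) := by
    intro w hw
    obtain ⟨⟨hwr, -⟩, _, ⟨z, hz, rfl⟩, hzx⟩ := hF w hw
    have h1 : dist (wordMap ψ w a) (wordMap ψ w z) ≤ E * r := by
      rw [hE, div_mul_eq_mul_div, le_div_iff₀ hd]
      calc dist (wordMap ψ w a) (wordMap ψ w z) * d
          ≤ C * dist (wordMap ψ w a) (wordMap ψ w a') * dist a z :=
            hdist w a haK z hz a haK a' ha'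
        _ ≤ C * r * diam K := by
            gcongr
            exact dist_le_diam_of_mem hK.isBounded haK hz
        _ = _ := by ring
    refine ball_subset_ball' ?_
    have h2 := dist_triangle (wordMap ψ w a) (wordMap ψ w z) x
    have h3 : dist (wordMap ψ w z) x ≤ r := hzx
    have h4 : 0 < κ * r := by positivity
    linarith
  have hpd : (F : Set (List ι)).PairwiseDisjoint fun w => ball (wordMap ψ w a) (κ * r / 2) := by
    intro u hu v hv huv
    exact (disjoint_wordMap_image hmapsV hinj hdisj
      (not_prefix_of_mem_stoppedWords (hF u hu).1 (hF v hv).1 huv)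
      (not_prefix_of_mem_stoppedWords (hF v hv).1 (hF u hu).1 huv.symm)).mono
        (hball u hu) (hball v hv)
  have hcard := card_mul_sq_le_of_disjoint_balls (by positivity) (by positivity) hpd hnear
  have h1 : (F.card : ℝ) ≤ (1 + E + κ) ^ 2 * 4 / κ ^ 2 := by
    rw [le_div_iff₀ (by positivity)]
    have hr2 : 0 < r ^ 2 := by positivity
    refine le_of_mul_le_mul_right ?_ hr2
    linarith
  exact_mod_cast h1.trans (Nat.le_ceil _)

/-! ### Lower bound for the dimension -/

/-- If boundedly many stopped words have images that meet a disc of comparable radius, then the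
range of the coding map has dimension at least the similarity dimension of the lower
contraction ratios. -/
lemma ofReal_le_dimH_range_codingMap {ι X : Type*} [Fintype ι] [TopologicalSpace ι]
    [DiscreteTopology ι] [MetricSpace X]
    {ψ : ι → X → X} {K : Set X} {c s : ℝ} {b : ι → ℝ} {a a' : X} {N : ℕ}
    (hc : 0 ≤ c) (hc1 : c < 1) (hb : ∀ i, 0 < b i) (hs : 0 < s) (hsum : ∑ i, b i ^ s = 1)
    (hmaps : ∀ i, MapsTo (ψ i) K K)
    (hup : ∀ i, ∀ x ∈ K, ∀ y ∈ K, dist (ψ i x) (ψ i y) ≤ c * dist x y)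
    (hlow : ∀ i, ∀ x ∈ K, ∀ y ∈ K, b i * dist x y ≤ dist (ψ i x) (ψ i y))
    (ha : a ∈ K) (ha' : a' ∈ K) (haa' : a ≠ a')
    (hN : ∀ r, 0 < r → r < dist a a' → ∀ x, ∀ F : Finset (List ι),
      (∀ w ∈ F, w ∈ stoppedWords (fun w => dist (wordMap ψ w a) (wordMap ψ w a')) r ∧
        (wordMap ψ w '' K ∩ closedBall x r).Nonempty) → F.card ≤ N)
    {φ : (ℕ → ι) → X} (hφc : Continuous φ) (hφK : ∀ ω, φ ω ∈ K) (hφ : ∀ ω, φ ω = ψ (ω 0) (φ fun k => ω (k + 1))) :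
    ENNReal.ofReal s ≤ dimH (range φ) := by
  classical
  let _ : MeasurableSpace ι := ⊤
  have : BorelSpace ι := ⟨borel_eq_top_of_discrete.symm⟩
  let _ : MeasurableSpace X := borel X
  have : BorelSpace X := ⟨rfl⟩
  obtain ⟨μ, hμ, hcyl⟩ := exists_bernoulli_measure (q := fun i => b i ^ s)
    (fun i => (Real.rpow_pos_of_pos (hb i) s).le) hsum
  set d := dist a a'
  have hd : 0 < d := dist_pos.2 haa'
  have hφm : Measurable φ := hφc.measurable
  refine ofReal_le_dimH_of_measure_closedBall_le (ν := μ.map φ) (C := N * (d ^ s)⁻¹) hs hd ?_ ?_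
  · intro x r hr hrd
    rw [Measure.map_apply hφm measurableSet_closedBall]
    set A : Set (List ι) := {w | w ∈ stoppedWords
      (fun w => dist (wordMap ψ w a) (wordMap ψ w a')) r ∧
        (wordMap ψ w '' K ∩ closedBall x r).Nonempty}
    have hA : A.Finite := by
      by_contra hinf
      obtain ⟨F, hFA, hF⟩ := Set.Infinite.exists_subset_card_eq hinf (N + 1)
      have := hN r hr hrd x F fun w hw => hFA hw
      lia
    have hcard : hA.toFinset.card ≤ N := hN r hr hrd x _ fun w hw => (hA.mem_toFinset.1 hw)
    have hcover : φ ⁻¹' closedBall x r ⊆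
        ⋃ w ∈ hA.toFinset, {ω | initialWord ω w.length = w} := by
      intro ω hω
      have h0 : Tendsto (fun n : ℕ => c ^ n * d) atTop (𝓝 0) := by
        simpa using (tendsto_pow_atTop_nhds_zero_of_lt_one hc hc1).mul_const d
      obtain ⟨n, hn⟩ := (h0.eventually_lt_const hr).exists
      have hωn := dist_wordMap_le hc hmaps hup (initialWord ω n) ha ha'
      rw [length_initialWord] at hωn
      obtain ⟨k, hk⟩ := exists_initialWord_mem_stoppedWords (ω := ω)
        (l := fun w => dist (wordMap ψ w a) (wordMap ψ w a')) (r := r)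
        ⟨n, hωn.trans hn.le⟩
      refine mem_iUnion₂.2 ⟨initialWord ω k, hA.mem_toFinset.2 ⟨hk, φ ω, ?_, hω⟩, ?_⟩
      · exact codingMap_mem_image hφK hφ k ω
      · simp
    -- The product of the lower ratios times `d` is at most the size of `w`, hence at most `r`;
    -- raise this to the power `s`.
    have hmass : ∀ w ∈ hA.toFinset, μ {ω | initialWord ω w.length = w} ≤
        ENNReal.ofReal ((r / d) ^ s) := by
      intro w hw
      refine (hcyl w).trans (ENNReal.ofReal_le_ofReal ?_)
      rw [Real.list_prod_map_rpow' _ _ fun i _ => (hb i).le]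
      have h1 := (le_dist_wordMap hb hmaps hlow w ha ha').trans (hA.mem_toFinset.1 hw).1.1
      have h2 : 0 ≤ (w.map b).prod := List.prod_nonneg fun t ht => by
        obtain ⟨i, -, rfl⟩ := List.mem_map.1 ht
        exact (hb i).le
      gcongr
      rwa [le_div_iff₀ hd]
    calc μ (φ ⁻¹' closedBall x r)
        ≤ ∑ w ∈ hA.toFinset, μ {ω | initialWord ω w.length = w} :=
          (measure_mono hcover).trans (measure_biUnion_finset_le _ _)
      _ ≤ hA.toFinset.card • ENNReal.ofReal ((r / d) ^ s) := Finset.sum_le_card_nsmul _ _ _ hmass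
      _ ≤ N * ENNReal.ofReal ((r / d) ^ s) := by
          rw [nsmul_eq_mul]
          gcongr
      _ = ENNReal.ofReal (N * (d ^ s)⁻¹ * r ^ s) := by
          rw [← ENNReal.ofReal_natCast, ← ENNReal.ofReal_mul (by positivity),
            Real.div_rpow hr.le hd.le]
          congr 1
          ring
  -- The range of `φ` carries the full mass 1 of the image measure.
  · intro h0
    have h1 := Measure.le_map_apply hφm.aemeasurable (μ := μ) (range φ)
    simp [h0] at h1

/-! ### Assembly on the compact set `closure V` -/

theorem mainTheorem8 {m : ℕ} (Ω : Set ℂ) (ψ : Fin m → ℂ → ℂ)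
    (hconf : IsConformalIFS Ω ψ) (hosc : OpenSetCondition Ω ψ)
    (b : Fin m → ℝ) (hb : ∀ i, 0 < b i ∧ b i < 1)
    (hlow : ∀ i, ∀ x ∈ Ω, ∀ y ∈ Ω, b i * ‖x - y‖ ≤ ‖ψ i x - ψ i y‖) :
    (∃! J : Set ℂ, IsAttractor Ω ψ J) ∧
    (∃! s : ℝ, 0 < s ∧ ∑ i, b i ^ s = 1) ∧
    ∀ (J : Set ℂ) (s : ℝ), IsAttractor Ω ψ J → 0 < s → ∑ i, b i ^ s = 1 →
      ENNReal.ofReal s ≤ dimH J := by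
  have hm := hconf.isIFS.two_le
  have : Nonempty (Fin m) := ⟨⟨0, by lia⟩⟩
  choose hmapsΩ c₀ hc₀ hc₀1 hup₀ using hconf.isIFS.contracting
  obtain ⟨i₀, hi₀⟩ := Finite.exists_max c₀
  set c := c₀ i₀
  have hc : 0 ≤ c := (hc₀ i₀).le
  have hc1 : c < 1 := hc₀1 i₀
  have hup : ∀ i, ∀ x ∈ Ω, ∀ y ∈ Ω, dist (ψ i x) (ψ i y) ≤ c * dist x y := fun i x hx y hy =>
    (hup₀ i x hx y hy).trans (mul_le_mul_of_nonneg_right (hi₀ i) dist_nonneg)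
  obtain ⟨j₀, hj₀⟩ := Finite.exists_min b
  have hlowb : ∀ i, ∀ x ∈ Ω, ∀ y ∈ Ω, b i * dist x y ≤ dist (ψ i x) (ψ i y) := by
    simpa only [dist_eq_norm] using hlow
  have hlowβ : ∀ i, ∀ x ∈ Ω, ∀ y ∈ Ω, b j₀ * dist x y ≤ dist (ψ i x) (ψ i y) :=
    fun i x hx y hy =>
      (mul_le_mul_of_nonneg_right (hj₀ i) dist_nonneg).trans (hlowb i x hx y hy)
  obtain ⟨V, hVne, hVb, hVo, hVΩ, hVmaps, hVdisj⟩ := hosc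
  have hmapsV : ∀ i, MapsTo (ψ i) V V := fun i => mapsTo_iff_image_subset.2 (hVmaps i)
  set K := closure V with hKdef
  have hVK : V ⊆ K := subset_closure
  have hK : IsCompact K := hVb.isCompact_closure
  have hKne : K.Nonempty := hVne.closure
  have hmaps : ∀ i, MapsTo (ψ i) K K := fun i =>
    (hmapsV i).closure_of_continuousOn <|
      (LipschitzOnWith.of_dist_le_mul (K := ⟨c, hc⟩) fun x hx y hy =>
        hup i x (hVΩ hx) y (hVΩ hy)).continuousOn
  have hupK : ∀ i, ∀ x ∈ K, ∀ y ∈ K, dist (ψ i x) (ψ i y) ≤ c * dist x y :=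
    fun i x hx y hy => hup i x (hVΩ hx) y (hVΩ hy)
  obtain ⟨φ, hφc, hφK, hφ⟩ := exists_codingMap hK hKne hc hc1 hmaps hupK
  have hattr : IsAttractor Ω ψ (range φ) :=
    ⟨range_nonempty φ, isCompact_range hφc, (range_subset_iff.2 hφK).trans hVΩ,
      range_codingMap hφ⟩
  have hle : ∀ {A B : Set ℂ}, IsAttractor Ω ψ A → IsAttractor Ω ψ B → A ⊆ B := fun hA hB =>
    subset_of_subset_iUnion_image hc1 hup hA.isCompact hA.subset hA.eq_iUnion.subset hB.isCompact
      hB.nonempty hB.subset fun i => mapsTo_iff_image_subset.2 <|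
        (subset_iUnion _ i).trans hB.eq_iUnion.superset
  refine ⟨⟨_, hattr, fun J hJ => (hle hJ hattr).antisymm (hle hattr hJ)⟩,
    existsUnique_rpow_sum_eq_one (by rwa [Fintype.card_fin]) hb, fun J s hJ hs hsum => ?_⟩
  rw [(hle hJ hattr).antisymm (hle hattr hJ)]
  obtain ⟨W, f, hW, hΩW, hf⟩ := hconf.exists_extension
  obtain ⟨C, hC, hdist⟩ := exists_bounded_distortion hK hc hc1 (hb j₀).1 hmaps hupK
    (fun i x hx y hy => hlowβ i x (hVΩ hx) y (hVΩ hy))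
    (fun i => ⟨W, f i, hW, hVΩ.trans hΩW, (hf i).1.1, (hf i).2.2.mono hVΩ⟩)
  obtain ⟨a, ha⟩ := hVne
  obtain ⟨a', ha', hne⟩ : ∃ a' ∈ V, a' ≠ a :=
    (infinite_of_mem_nhds a (hVo.mem_nhds ha)).nontrivial.exists_ne a
  obtain ⟨N, hN⟩ := exists_card_stoppedWords_le hK hVo hVK (hb j₀).1 hmaps hmapsV
    (fun i => ((hf i).1.1.mono (hVK.trans (hVΩ.trans hΩW))).congr fun x hx =>
      ((hf i).2.2 (hVΩ (hVK hx))).symm)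
    (fun i x hx y hy => hlowβ i x (hVΩ hx) y (hVΩ hy)) hVdisj ha (hVK ha') hne.symm hC hdist
  exact ofReal_le_dimH_range_codingMap hc hc1 (fun i => (hb i).1) hs hsum hmaps hupK
    (fun i x hx y hy => hlowb i x (hVΩ hx) y (hVΩ hy)) (hVK ha) (hVK ha') hne.symm hN hφc hφK hφ
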